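/- All graphs are finite, simple and nonempty. A \emph{cover} of a graph $G$ is a pair $\mathcal{H}=(L,H)$, where $H$ is a graph and $L:V(G)\to\mathcal{P}(V(H))$ satisfies: (1) the sets $L(u)$, $u\in V(G)$, are pairwise distinct and form a partition of $V(H)$; (2) $H[L(u)]$ is complete for every $u\in V(G)$; (3) if $H$ has an edge between $L(u)$ and $L(v)$, then $u=v$ or $uv\in E(G)$; (4) if $uv\in E(G)$, the edges of $H$ between $L(u)$ and $L(v)$ form a (possibly empty) matching. The cover is \emph{$m$-fold} if $|L(u)|=m$ for all $u\in V(G)$, and an \emph{$\mathcal{H}$-coloring} of $G$ is an independent set of $H$ of size $|V(G)|$. For a positive integer $m$, let $P_{DP}(G,m)$ be the minimum, over all $m$-fold covers $\mathcal{H}$ of $G$, of the number of $\mathcal{H}$-colorings of $G$, and let $P(G,m)$ be the number of proper $m$-colorings of $G$ (with colors in $\{1,\dots,m\}$). Let $\tau_{DP}(G)$ be the smallest integer $N\geq\chi(G)$ such that $P_{DP}(G,m)=P(G,m)$ for all $m\geq N$ (and $\tau_{DP}(G)=\infty$ if there is no such $N$). \textbf{Theorem.} Let $n\geq 2$ and $k_1,\dots,k_n\geq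 3$ be integers, let $G$ be the disjoint union of cycles $C_{k_1},\dots,C_{k_n}$, and let $M=K_1\vee G$ be the cone of $G$, obtained from $G$ by adding one new vertex adjacent to all vertices of $G$. Then $P_{DP}(M,m)=P(M,m)$ for every integer $m\geq 5$. Consequently, $\tau_{DP}(M)\leq 5$. -/

import Mathlib

open SimpleGraph

namespace DPColoring

universe u

/-- The join of two vertex-disjoint graphs. -/
def join {V W : Type*} (G : SimpleGraph V) (H : SimpleGraph W) : SimpleGraph (V ⊕ W) :=
  (G ⊕g H) ⊔ completeBipartiteGraph V W

/-- The cone of `G`: the join of the one-vertex complete graph with `G`. -/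
def cone {V : Type*} (G : SimpleGraph V) : SimpleGraph (Fin 1 ⊕ V) :=
  join (completeGraph (Fin 1)) G

/-- The disjoint union of a family of graphs. -/
def disjointUnion {ι : Type*} {V : ι → Type*} (G : ∀ i, SimpleGraph (V i)) :
    SimpleGraph (Σ i, V i) where
  Adj x y := ∃ i, ∃ a b : V i, (G i).Adj a b ∧ x = ⟨i, a⟩ ∧ y = ⟨i, b⟩
  symm := ⟨by
    rintro x y ⟨i, a, b, h, rfl, rfl⟩
    exact ⟨i, b, a, h.symm, rfl, rfl⟩⟩
  loopless := ⟨by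
    rintro x ⟨i, a, b, h, rfl, hb⟩
    simp only [Sigma.mk.injEq, heq_eq_eq, true_and] at hb
    exact h.ne hb⟩

/-- A cover `(L, H)` of the graph `G`, where the graph `H` has vertex set `W`. -/
structure Cover {V : Type*} (G : SimpleGraph V) (W : Type*) where
  /-- The covering graph. -/
  H : SimpleGraph W
  /-- The list of vertices of `H` attached to a vertex of `G`. -/
  L : V → Set W
  /-- The sets `L u` partition the vertices of `H` ... -/
  isPartition : Setoid.IsPartition (Set.range L)
  /-- ... and distinct vertices of `G` have distinct parts. -/
  injective : Function.Injective L
  /-- Every `L u` induces a complete subgraph of `H`. -/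
  isClique : ∀ u, H.IsClique (L u)
  /-- Edges of `H` lie inside a part or run between parts of adjacent vertices of `G`. -/
  eq_or_adj : ∀ u v, ∀ x ∈ L u, ∀ y ∈ L v, H.Adj x y → u = v ∨ G.Adj u v
  /-- For adjacent `u` and `v`, the edges of `H` between `L u` and `L v` form a matching: no two of
  them share their endpoint in `L u`, nor (exchanging `u` and `v`) their endpoint in `L v`. -/
  matching : ∀ u v, G.Adj u v →
    ∀ x ∈ L u, ∀ y ∈ L v, ∀ y' ∈ L v, H.Adj x y → H.Adj x y' → y = y'

/-- The cover is `m`-fold: every `L u` has exactly `m` elements. -/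
def Cover.IsFold {V W : Type*} {G : SimpleGraph V} (C : Cover G W) (m : ℕ) : Prop :=
  ∀ u, (C.L u).Finite ∧ (C.L u).ncard = m

/-- The set of colorings of `G` from the cover `C = (L, H)`: the independent sets of `H` of
size `|V(G)|`. -/
def Cover.colorings {V W : Type*} {G : SimpleGraph V} (C : Cover G W) : Set (Finset W) :=
  {s | C.H.IsNIndepSet (Nat.card V) s}

/-- The number of colorings of `G` from the cover `C`. -/
noncomputable def Cover.numColorings {V W : Type*} {G : SimpleGraph V} (C : Cover G W) : ℕ :=
  C.colorings.ncard

/-- `P_DP(G, m)`: the minimum number of colorings over all `m`-fold covers of `G`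
(all graphs being finite). -/
noncomputable def dpColorFunction {V : Type u} (G : SimpleGraph V) (m : ℕ) : ℕ :=
  sInf {N | ∃ (W : Type u) (_ : Finite W) (C : Cover G W), C.IsFold m ∧ C.numColorings = N}

/-- `P(G, m)`: the number of proper `m`-colorings of `G`. -/
noncomputable def chromaticPoly {V : Type*} (G : SimpleGraph V) (m : ℕ) : ℕ :=
  Nat.card (G.Coloring (Fin m))

/-- The DP color function threshold: the smallest `N ≥ χ(G)` with `P_DP(G, m) = P(G, m)` for all
`m ≥ N`, and `⊤` if there is no such `N`. -/
noncomputable def dpThreshold {V : Type u} (G : SimpleGraph V) : ℕ∞ :=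
  ⨅ N ∈ {N : ℕ | G.chromaticNumber ≤ (N : ℕ∞) ∧
    ∀ m : ℕ, N ≤ m → dpColorFunction G m = chromaticPoly G m}, (N : ℕ∞)

/-- The cover with a canonical labeling: `L u = {(u, j) : j}`, with `(u, j)` and `(v, j)` adjacent
whenever `u` and `v` are. -/
def canonicalCover {V : Type*} (G : SimpleGraph V) (m : ℕ) (hm : 1 ≤ m) :
    Cover G (V × Fin m) where
  H := G □ completeGraph (Fin m)
  L u := {x | x.1 = u}
  isPartition := by
    refine ⟨?_, fun x => ⟨{y | y.1 = x.1}, ⟨⟨x.1, rfl⟩, rfl⟩, ?_⟩⟩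
    · rintro ⟨u, hu⟩
      have : ((u, ⟨0, hm⟩) : V × Fin m) ∈ ({x | x.1 = u} : Set (V × Fin m)) := rfl
      exact (Set.ext_iff.1 hu _).1 this
    · rintro _ ⟨⟨u, rfl⟩, hx⟩
      have hx : x.1 = u := hx
      rw [hx]
  injective u v h := by
    have : ((u, ⟨0, hm⟩) : V × Fin m) ∈ ({x | x.1 = u} : Set (V × Fin m)) := rfl
    simp only at h
    rw [h] at this
    exact this
  isClique u := by
    rintro ⟨a, i⟩ ha ⟨b, j⟩ hb hne
    simp only [Set.mem_ofPred_eq] at ha hb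
    subst ha hb
    simpa [boxProd_adj] using hne
  eq_or_adj u v := by
    rintro ⟨a, i⟩ ha ⟨b, j⟩ hb h
    simp only [Set.mem_ofPred_eq] at ha hb
    subst ha hb
    rw [boxProd_adj] at h
    tauto
  matching u v huv := by
    rintro ⟨a, i⟩ ha ⟨b, j⟩ hb ⟨c, l⟩ hc h h'
    simp only [Set.mem_ofPred_eq] at ha hb hc
    subst ha hb hc
    have := huv.ne
    rw [boxProd_adj] at h h'
    simp_all

/-- For `m ≥ 1` there are `m`-fold covers, so the minimum defining `P_DP(G, m)` is attained. -/
theorem exists_cover_eq_dpColorFunction {V : Type u} [Finite V] (G : SimpleGraph V) {m : ℕ}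
    (hm : 1 ≤ m) : ∃ (W : Type u) (_ : Finite W) (C : Cover G W),
      C.IsFold m ∧ C.numColorings = dpColorFunction G m := by
  refine Nat.sInf_mem (s := {N | ∃ (W : Type u) (_ : Finite W) (C : Cover G W),
    C.IsFold m ∧ C.numColorings = N})
    ⟨_, V × Fin m, inferInstance, canonicalCover G m hm, fun u => ⟨Set.toFinite _, ?_⟩, rfl⟩
  have : (canonicalCover G m hm).L u = Set.range (fun i : Fin m => (u, i)) := by
    ext ⟨a, i⟩
    simp [canonicalCover, eq_comm]
  rw [this, ← Set.image_univ, Set.ncard_image_of_injective _ (Prod.mk_right_injective u),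
    Set.ncard_univ, Nat.card_eq_fintype_card, Fintype.card_fin]

end DPColoring

/-! The canonical cover gives `P_DP ≤ P`, so the work is a lower bound for an arbitrary cover. Label
every list through the apex so that each spoke edge joins equal labels, and extend the rim matchings
to permutations; neither extension creates colorings. When the apex has color `j`, the cycles
decouple, so there are at least `∑ j, ∏ i, avoidCount (σ i) j` colorings, while the proper colorings
number `m * ∏ i, cyclePoly k_i m`. By AM-GM over `j` (`card_mul_prod_le_sum_prod`) it suffices to
treat one cycle: the geometric mean over `j` of `avoidCount σ j` is at least `cyclePoly k m`
(`pow_le_prod_avoidCount`).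

Deleting `j` from every list of a `k`-cycle leaves partial matchings on `m - 1` colors, which
`bypass` completes. A full cover of the cycle has `(m-2)^k + (-1)^k (F - 1)` colorings, where `F`
counts the fixed points of the composed permutation. For odd `k`, `F ≤ m - 1` gives the bound for
each `j` separately. For even `k` a twisted cover may lose up to `m - 2` or so colorings at a color
`j` fixed by all permutations, but at a color moved by some permutation an edge of the matching is
genuinely missing, which gains about `(m-2)^(k-1)/(m-1)` colorings. `pow_le_of_walkNum` shows that
the gains outweigh the losses in the product once `m ≥ 5`. -/

namespace DPColoring

/-! ### Transfer matrices and colorings of a cycle -/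

/-- The number of walks of length `L` in the complete graph on `n` vertices between two given
distinct vertices. -/
def walkNum (n : ℤ) : ℕ → ℤ
  | 0 => 0
  | L + 1 => (n - 1) ^ L - walkNum n L

theorem mul_walkNum (n : ℤ) (L : ℕ) : n * walkNum n L = (n - 1) ^ L - (-1) ^ L := by
  induction L with
  | zero => simp [walkNum]
  | succ L ih => rw [walkNum, mul_sub, ih]; ring

/-- The composition of the permutations along a path. -/
def pathPerm {α : Type*} : (L : ℕ) → (Fin L → Equiv.Perm α) → Equiv.Perm α
  | 0, _ => 1
  | L + 1, π => π (Fin.last L) * pathPerm L fun i => π i.castSucc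

theorem pathPerm_apply_eq_self {α : Type*} (a : α) :
    ∀ (L : ℕ) (π : Fin L → Equiv.Perm α), (∀ i, π i a = a) → pathPerm L π a = a
  | 0, _, _ => rfl
  | L + 1, π, h => by
    rw [pathPerm, Equiv.Perm.mul_apply, pathPerm_apply_eq_self a L _ fun i => h i.castSucc, h]

variable {α : Type*} [Fintype α] [DecidableEq α]

/-- Sums over walks avoiding the transitions `x ↦ π i x`, weighted by a function of the
endpoints. -/
theorem sum_walks (L : ℕ) (π : Fin L → Equiv.Perm α) (g : α → α → ℤ) :
    ∑ f : Fin (L + 1) → α,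
        (∏ i : Fin L, if f i.succ = π i (f i.castSucc) then (0 : ℤ) else 1) *
          g (f 0) (f (Fin.last L)) =
      ∑ x, ∑ y, (walkNum (Fintype.card α) L +
        (-1) ^ L * if y = pathPerm L π x then 1 else 0) * g x y := by
  -- With `J` the all-ones matrix, each step has transfer matrix `J - P`, `P` a permutation matrix.
  -- Since `J P = P J = J`, a product of `L` of them is a multiple of `J` plus `(-1)^L` times the
  -- matrix of the composed permutation.
  induction L generalizing g with
  | zero =>
    rw [← (Equiv.funUnique (Fin 1) α).symm.sum_comp]
    simp only [walkNum, pathPerm, Equiv.Perm.one_apply]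
    have h (x : α) : ∑ y, (0 + (-1) ^ 0 * if y = x then (1 : ℤ) else 0) * g x y = g x x := by
      simp
    refine Eq.trans ?_ (Finset.sum_congr rfl fun x _ => (h x).symm)
    simp
  | succ L ih =>
    -- The last vertex is split off and its transition is absorbed into the weight, hence the
    -- induction over all `g`.
    have h1 : ∑ f : Fin (L + 2) → α,
        (∏ i : Fin (L + 1), if f i.succ = π i (f i.castSucc) then (0 : ℤ) else 1) *
          g (f 0) (f (Fin.last (L + 1))) =
        ∑ f : Fin (L + 1) → α,
          (∏ i : Fin L, if f i.succ = π i.castSucc (f i.castSucc) then (0 : ℤ) else 1) *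
            ∑ y, (if y = π (Fin.last L) (f (Fin.last L)) then 0 else 1) * g (f 0) y := by
      rw [← (Fin.snocEquiv fun _ => α).sum_comp, Fintype.sum_prod_type, Finset.sum_comm]
      refine Finset.sum_congr rfl fun f _ => ?_
      rw [Finset.mul_sum]
      refine Finset.sum_congr rfl fun y _ => ?_
      have h0 : (Fin.snoc f y : Fin (L + 2) → α) 0 = f 0 := by
        rw [← Fin.castSucc_zero, Fin.snoc_castSucc]
      rw [Fin.prod_univ_castSucc]
      simp only [Fin.snocEquiv_apply, Fin.snoc_last, Fin.snoc_castSucc, Fin.succ_last, h0,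
        ← Fin.castSucc_succ]
      ring
    rw [h1, ih (fun i => π i.castSucc)
      (fun x z => ∑ y, (if y = π (Fin.last L) z then 0 else 1) * g x y)]
    refine Finset.sum_congr rfl fun x _ => ?_
    simp only [Finset.mul_sum]
    rw [Finset.sum_comm]
    refine Finset.sum_congr rfl fun y _ => ?_
    simp only [← mul_assoc]
    rw [← Finset.sum_mul]
    congr 1
    have h2 : ∀ z, (if y = π (Fin.last L) z then (0 : ℤ) else 1) =
        1 - if z = (π (Fin.last L)).symm y then 1 else 0 := by
      intro z
      simp only [Equiv.eq_symm_apply, eq_comm (a := y)]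
      split_ifs <;> simp
    simp only [h2, mul_sub, mul_one, mul_ite, mul_zero, Finset.sum_sub_distrib,
      Finset.sum_add_distrib, Finset.sum_const, Finset.sum_ite_eq', Finset.mem_univ, if_true,
      Finset.card_univ, nsmul_eq_mul, mul_walkNum]
    have h3 : (π (Fin.last L)).symm y = pathPerm L (fun i => π i.castSucc) x ↔
        y = pathPerm (L + 1) π x := Equiv.symm_apply_eq _
    by_cases h : y = pathPerm (L + 1) π x
    · rw [if_pos (h3.2 h), if_pos h, walkNum]; ring
    · rw [if_neg (mt h3.1 h), if_neg h, walkNum]; ring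

theorem cast_card_walks {L : ℕ} (π : Fin L → Equiv.Perm α) (R : α → α → Prop)
    [∀ x y, Decidable (R x y)] :
    (Nat.card {f : Fin (L + 1) → α //
        (∀ i : Fin L, f i.succ ≠ π i (f i.castSucc)) ∧ R (f 0) (f (Fin.last L))} : ℤ) =
      ∑ x, ∑ y, (walkNum (Fintype.card α) L +
        (-1) ^ L * if y = pathPerm L π x then 1 else 0) * if R x y then 1 else 0 := by
  rw [← sum_walks, Nat.card_eq_fintype_card, Fintype.card_subtype, Finset.card_eq_sum_ones,
    Finset.sum_filter]
  push_cast
  refine Finset.sum_congr rfl fun f _ => ?_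
  by_cases h : ∀ i : Fin L, f i.succ ≠ π i (f i.castSucc)
  · simp [h]
  · rw [if_neg fun h' => h h'.1]
    push Not at h
    obtain ⟨i, hi⟩ := h
    have h0 : (∏ i : Fin L, if f i.succ = π i (f i.castSucc) then (0 : ℤ) else 1) = 0 :=
      Finset.prod_eq_zero (Finset.mem_univ i) (if_pos hi)
    rw [h0, zero_mul]

theorem forall_cycle_iff {L : ℕ} (P : Fin (L + 1) → Fin (L + 1) → Prop) :
    (∀ v, P v (v + 1)) ↔ (∀ i : Fin L, P i.castSucc i.succ) ∧ P (Fin.last L) 0 := by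
  rw [Fin.forall_fin_succ']
  simp [Fin.coeSucc_eq_succ]

/-- Closing the walk multiplies by one more `J - P` and takes the trace; the trace of a permutation
matrix is its number of fixed points. -/
theorem sum_walks_closed {L : ℕ} (σ τ ρ : Equiv.Perm α) (hρ : ∀ x, ρ x = σ (τ x)) :
    ∑ x, ∑ y, (walkNum (Fintype.card α) L + (-1) ^ L * if y = τ x then 1 else 0) *
        (if x ≠ σ y then 1 else 0) =
      (Fintype.card α - 1) ^ (L + 1) +
        (-1) ^ (L + 1) * ((Finset.univ.filter fun x => ρ x = x).card - 1 : ℤ) := by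
  have h2 : ∀ x y, (if x ≠ σ y then (1 : ℤ) else 0) = 1 - if y = σ.symm x then 1 else 0 := by
    intro x y
    simp only [Equiv.eq_symm_apply, ne_eq, ite_not, eq_comm (a := x)]
    split_ifs <;> simp
  have h3 : ∀ x, (∑ y, (walkNum (Fintype.card α) L + (-1) ^ L * if y = τ x then 1 else 0) *
        (if x ≠ σ y then 1 else 0)) = walkNum (Fintype.card α) (L + 1) +
          (-1) ^ (L + 1) * if ρ x = x then 1 else 0 := by
    intro x
    simp only [h2, mul_sub, mul_one, mul_ite, mul_zero, Finset.sum_sub_distrib,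
      Finset.sum_add_distrib, Finset.sum_const, Finset.sum_ite_eq', Finset.mem_univ, if_true,
      Finset.card_univ, nsmul_eq_mul, mul_walkNum]
    simp only [walkNum, Equiv.symm_apply_eq, eq_comm (a := x), hρ]
    split_ifs <;> ring
  simp only [h3, Finset.sum_add_distrib, Finset.sum_const, Finset.card_univ, nsmul_eq_mul,
    mul_walkNum, ← Finset.mul_sum, Finset.sum_boole]
  ring

/-- The number of colorings of a cycle from a full cover. -/
theorem cast_card_cycle {L : ℕ} (π : Fin (L + 1) → Equiv.Perm α) :
    (Nat.card {f : Fin (L + 1) → α // ∀ v, f (v + 1) ≠ π v (f v)} : ℤ) =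
      (Fintype.card α - 1) ^ (L + 1) + (-1) ^ (L + 1) *
        ((Finset.univ.filter fun x => pathPerm (L + 1) π x = x).card - 1 : ℤ) := by
  rw [← sum_walks_closed (π (Fin.last L)) (pathPerm L fun i => π i.castSucc)
    (pathPerm (L + 1) π) fun x => rfl, ← cast_card_walks _ fun x y => x ≠ π (Fin.last L) y]
  congr 1
  refine Nat.card_congr (Equiv.subtypeEquivRight fun f => ?_)
  exact forall_cycle_iff fun v w => f w ≠ π v (f v)

/-- The number of colorings of a cycle from a cover in which one edge, closing up the cycle,
is missing from the matchings. -/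
theorem cast_card_cycle_missing {L : ℕ} (π : Fin (L + 1) → Equiv.Perm α) (b : α) :
    (Nat.card {f : Fin (L + 1) → α // (∀ i : Fin L, f i.succ ≠ π i.castSucc (f i.castSucc)) ∧
        (f 0 = π (Fin.last L) (f (Fin.last L)) → f (Fin.last L) = b)} : ℤ) =
      (Fintype.card α - 1) ^ (L + 1) + (-1) ^ (L + 1) *
        ((Finset.univ.filter fun x => pathPerm (L + 1) π x = x).card - 1 : ℤ) +
      (walkNum (Fintype.card α) L +
        (-1) ^ L * if pathPerm (L + 1) π (π (Fin.last L) b) = π (Fin.last L) b then 1 else 0) := by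
  classical
  rw [cast_card_walks (fun i => π i.castSucc) fun x y => x = π (Fin.last L) y → y = b]
  rw [← sum_walks_closed (π (Fin.last L)) (pathPerm L fun i => π i.castSucc)
    (pathPerm (L + 1) π) fun x => rfl]
  -- Removing the edge at `b` admits exactly the additional walks that start at `π (Fin.last L) b`
  -- and end at `b`.
  have h : ∀ x y, (if x = π (Fin.last L) y → y = b then (1 : ℤ) else 0) =
      (if x ≠ π (Fin.last L) y then 1 else 0) +
        if y = b then (if x = π (Fin.last L) b then 1 else 0) else 0 := by
    intro x y
    by_cases hy : y = b
    · subst hy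
      by_cases hx : x = π (Fin.last L) y <;> simp [hx]
    · simp [hy]
  simp only [h, mul_add, Finset.sum_add_distrib]
  congr 1
  simp only [mul_ite, mul_zero, mul_one, Finset.sum_ite_eq', Finset.mem_univ, if_true]
  simp only [pathPerm, Equiv.Perm.mul_apply, Equiv.apply_eq_iff_eq, eq_comm (a := b)]

end DPColoring

/-! ### Cycle colorings avoiding a given color -/

namespace DPColoring

variable {β : Type*}

/-- The number of colorings of a cycle, from the cover given by the permutations `σ`, in which
no vertex gets the color `j`. -/
noncomputable def avoidCount {L : ℕ} (σ : Fin (L + 1) → Equiv.Perm β) (j : β) : ℕ :=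
  Nat.card {f : Fin (L + 1) → β // ∀ v, f v ≠ j ∧ f (v + 1) ≠ σ v (f v)}

theorem avoidCount_rotate {L : ℕ} (σ : Fin (L + 1) → Equiv.Perm β) (j : β) (t : Fin (L + 1)) :
    avoidCount (fun v => σ (v + t)) j = avoidCount σ j := by
  refine Nat.card_congr (Equiv.subtypeEquiv ((Equiv.addRight t).arrowCongr (Equiv.refl β)) ?_)
  intro f
  refine Iff.trans (forall_congr' fun v => ?_) (Equiv.addRight t).forall_congr_right
  have h : v + t + 1 - t = v + 1 := by abel
  simp [Equiv.arrowCongr, ← sub_eq_add_neg, h]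

variable [DecidableEq β]

/-- The permutation of the points other than `j` that agrees with `σ` wherever possible. -/
def bypass (σ : Equiv.Perm β) (j : β) : Equiv.Perm {x // x ≠ j} :=
  (Equiv.swap j (σ j) * σ).subtypePerm fun x => by
    rw [not_iff_not]
    rw [Equiv.Perm.mul_apply, Equiv.swap_apply_eq_iff, Equiv.swap_apply_left,
      Equiv.apply_eq_iff_eq]

theorem bypass_of_ne {σ : Equiv.Perm β} {j : β} {x : {x // x ≠ j}} (h : σ x ≠ j) :
    (bypass σ j x : β) = σ x := by
  have h' : σ x ≠ σ j := fun h => x.2 (σ.injective h)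
  simp [bypass, Equiv.swap_apply_of_ne_of_ne h h']

theorem bypass_of_eq {σ : Equiv.Perm β} {j : β} {x : {x // x ≠ j}} (h : σ x = j) :
    (bypass σ j x : β) = σ j := by
  simp [bypass, h]

theorem bypass_eq_self {σ : Equiv.Perm β} {j : β} {x : {x // x ≠ j}} (h : σ x = x) :
    bypass σ j x = x :=
  Subtype.ext ((bypass_of_ne (by rw [h]; exact x.2)).trans h)

variable [Fintype β]

/-- Each matching edge that survives the deletion of `j` is also an edge of `bypass`, so `bypass`
only adds constraints. -/
theorem card_bypass_le_avoidCount {L : ℕ} (σ : Fin (L + 1) → Equiv.Perm β) (j : β) :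
    Nat.card {f : Fin (L + 1) → {x // x ≠ j} // ∀ v, f (v + 1) ≠ bypass (σ v) j (f v)} ≤
      avoidCount σ j := by
  refine Nat.card_le_card_of_injective (fun f => ⟨fun v => f.1 v, fun v => ⟨(f.1 v).2, ?_⟩⟩) ?_
  · intro h
    exact f.2 v (Subtype.ext (h.trans (bypass_of_ne (by rw [← h]; exact (f.1 _).2)).symm))
  · intro f g h
    exact Subtype.ext (funext fun v => Subtype.ext (congrFun (congrArg Subtype.val h) v))

/-- If every permutation fixes `j`, then `bypass` adds no edge. This is what makes the count for the
identity permutations exact. -/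
theorem avoidCount_le_card_bypass {L : ℕ} (σ : Fin (L + 1) → Equiv.Perm β) (j : β)
    (hj : ∀ v, σ v j = j) :
    avoidCount σ j ≤
      Nat.card {f : Fin (L + 1) → {x // x ≠ j} // ∀ v, f (v + 1) ≠ bypass (σ v) j (f v)} := by
  refine Nat.card_le_card_of_injective (fun f => ⟨fun v => ⟨f.1 v, (f.2 v).1⟩, fun v h => ?_⟩) ?_
  · refine (f.2 v).2 ((congrArg Subtype.val h).trans (bypass_of_ne fun h' => ?_))
    exact (f.2 v).1 ((σ v).injective (h'.trans (hj v).symm))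
  · intro f g h
    exact Subtype.ext (funext fun v => congrArg Subtype.val (congrFun (congrArg Subtype.val h) v))

/-- The edge that `bypass` adds on the closing step, from the preimage `b` of `j` to the image of
`j`, comes from no edge of the cover, so it may be dropped. -/
theorem card_bypass_missing_le_avoidCount {L : ℕ} (σ : Fin (L + 1) → Equiv.Perm β) (j : β)
    (b : {x // x ≠ j}) (hb : σ (Fin.last L) b = j) :
    Nat.card {f : Fin (L + 1) → {x // x ≠ j} //
        (∀ i : Fin L, f i.succ ≠ bypass (σ i.castSucc) j (f i.castSucc)) ∧
          (f 0 = bypass (σ (Fin.last L)) j (f (Fin.last L)) → f (Fin.last L) = b)} ≤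
      avoidCount σ j := by
  have key : ∀ f : Fin (L + 1) → {x // x ≠ j}, ∀ v w, (f w : β) = σ v (f v) →
      f w = bypass (σ v) j (f v) := fun f v w h =>
    Subtype.ext (h.trans (bypass_of_ne (by rw [← h]; exact (f w).2)).symm)
  refine Nat.card_le_card_of_injective (fun f => ⟨fun v => f.1 v, ?_⟩) ?_
  · rw [forall_and, forall_cycle_iff fun v w => (f.1 w : β) ≠ σ v (f.1 v)]
    refine ⟨fun v => (f.1 v).2, fun i h => f.2.1 i (key _ _ _ h), fun h => ?_⟩
    rw [f.2.2 (key _ _ _ h), hb] at h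
    exact (f.1 0).2 h
  · intro f g h
    exact Subtype.ext (funext fun v => Subtype.ext (congrFun (congrArg Subtype.val h) v))

theorem cast_card_ne (j : β) : (Fintype.card {x // x ≠ j} : ℤ) = Fintype.card β - 1 := by
  have h := Fintype.card_subtype_compl fun x => x = j
  rw [Fintype.card_subtype_eq] at h
  have h1 : 0 < Fintype.card β := Fintype.card_pos_iff.2 ⟨j⟩
  change Fintype.card {x // ¬ x = j} = _ at h
  rw [h]
  omega

/-- The colors fixed by all of the permutations. -/
def fixedColors {L : ℕ} (σ : Fin (L + 1) → Equiv.Perm β) : Finset β :=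
  Finset.univ.filter fun x => ∀ v, σ v x = x

theorem mem_fixedColors {L : ℕ} {σ : Fin (L + 1) → Equiv.Perm β} {x : β} :
    x ∈ fixedColors σ ↔ ∀ v, σ v x = x := by
  simp [fixedColors]

theorem fixedColors_rotate {L : ℕ} (σ : Fin (L + 1) → Equiv.Perm β) (t : Fin (L + 1)) :
    fixedColors (fun v => σ (v + t)) = fixedColors σ := by
  ext x
  rw [mem_fixedColors, mem_fixedColors]
  exact (Equiv.addRight t).forall_congr_right (q := fun v => σ v x = x)

/-- Common fixed colors survive every `bypass`, hence the composition around the cycle. This bounds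
the number of fixed points from below, as even cycles require. -/
theorem erase_fixedColors_subset {L : ℕ} (σ : Fin (L + 1) → Equiv.Perm β) (j : β) :
    (fixedColors σ).erase j ⊆
      (Finset.univ.filter fun x => pathPerm (L + 1) (fun v => bypass (σ v) j) x = x).map
        (Function.Embedding.subtype _) := by
  intro x hx
  rw [Finset.mem_erase, mem_fixedColors] at hx
  simp only [Finset.mem_map, Finset.mem_filter, Finset.mem_univ, true_and]
  exact ⟨⟨x, hx.1⟩, pathPerm_apply_eq_self _ _ _ fun i => bypass_eq_self (hx.2 i), rfl⟩

/-- Odd cycles. -/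
theorem le_avoidCount_of_odd {L : ℕ} (hL : Even L) (σ : Fin (L + 1) → Equiv.Perm β) (j : β) :
    ((Fintype.card β : ℤ) - 2) ^ (L + 1) - (Fintype.card β - 2) ≤ avoidCount σ j := by
  refine le_trans ?_ (Int.ofNat_le.2 (card_bypass_le_avoidCount σ j))
  -- The cycle has odd length `L + 1`, so fixed points count negatively, and the trivial bound by
  -- all `m - 1` colors is enough.
  have h := Finset.card_le_univ (Finset.univ.filter fun x =>
    pathPerm (L + 1) (fun v => bypass (σ v) j) x = x)
  rw [cast_card_cycle, hL.add_one.neg_one_pow]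
  have h' := cast_card_ne j
  rw [h']
  have h2 : ((Fintype.card β : ℤ) - 1 - 1) = Fintype.card β - 2 := by ring
  rw [h2]
  omega

/-- Even cycles, with all permutations fixing the forbidden color. -/
theorem le_avoidCount_of_mem {L : ℕ} (hL : Odd L) (σ : Fin (L + 1) → Equiv.Perm β) {j : β}
    (hj : j ∈ fixedColors σ) :
    ((Fintype.card β : ℤ) - 2) ^ (L + 1) + (fixedColors σ).card - 2 ≤ avoidCount σ j := by
  refine le_trans ?_ (Int.ofNat_le.2 (card_bypass_le_avoidCount σ j))
  have h := Finset.card_le_card (erase_fixedColors_subset σ j)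
  rw [Finset.card_map, Finset.card_erase_of_mem hj] at h
  rw [cast_card_cycle, hL.add_one.neg_one_pow, cast_card_ne j]
  have h2 : ((Fintype.card β : ℤ) - 1 - 1) = Fintype.card β - 2 := by ring
  rw [h2]
  omega

/-- Even cycles, with the last permutation moving the forbidden color. -/
theorem le_avoidCount_of_last {L : ℕ} (hL : Odd L) (σ : Fin (L + 1) → Equiv.Perm β) {j : β}
    (hj : σ (Fin.last L) j ≠ j) :
    ((Fintype.card β : ℤ) - 2) ^ (L + 1) + (fixedColors σ).card - 1 +
      walkNum (Fintype.card β - 1) L ≤ avoidCount σ j := by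
  have hb : (σ (Fin.last L)).symm j ≠ j := fun h => hj ((Equiv.symm_apply_eq _).1 h).symm
  refine le_trans ?_ (Int.ofNat_le.2 (card_bypass_missing_le_avoidCount σ j
    ⟨(σ (Fin.last L)).symm j, hb⟩ ((σ (Fin.last L)).apply_symm_apply j)))
  rw [cast_card_cycle_missing (fun v => bypass (σ v) j), hL.add_one.neg_one_pow,
    hL.neg_one_pow, cast_card_ne j]
  have h2 : ((Fintype.card β : ℤ) - 1 - 1) = Fintype.card β - 2 := by ring
  rw [h2]
  set x := bypass (σ (Fin.last L)) j ⟨(σ (Fin.last L)).symm j, hb⟩ with hx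
  have hx' : (x : β) = σ (Fin.last L) j := bypass_of_eq ((σ (Fin.last L)).apply_symm_apply j)
  have hjS : j ∉ fixedColors σ := fun h => hj (mem_fixedColors.1 h _)
  have hsub := erase_fixedColors_subset σ j
  rw [Finset.erase_eq_of_notMem hjS] at hsub
  -- If the composition fixes `x`, the missing edge gains one walk fewer, but `x`, the image of `j`,
  -- is then a fixed point outside `fixedColors`, which compensates.
  by_cases hfix : pathPerm (L + 1) (fun v => bypass (σ v) j) x = x
  · have hxS : (x : β) ∉ fixedColors σ := by
      intro h
      rw [hx'] at h
      exact hj ((σ (Fin.last L)).injective (mem_fixedColors.1 h _))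
    have h := Finset.card_le_card (Finset.insert_subset (a := (x : β)) (by
      simp only [Finset.mem_map, Finset.mem_filter, Finset.mem_univ, true_and]
      exact ⟨x, hfix, rfl⟩) hsub)
    rw [Finset.card_map, Finset.card_insert_of_notMem hxS] at h
    rw [if_pos hfix]
    omega
  · have h := Finset.card_le_card hsub
    rw [Finset.card_map] at h
    rw [if_neg hfix]
    omega

/-- Some permutation moves `j`; rotating the cycle makes it the closing one. -/
theorem le_avoidCount_of_notMem {L : ℕ} (hL : Odd L) (σ : Fin (L + 1) → Equiv.Perm β) {j : β}
    (hj : j ∉ fixedColors σ) :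
    ((Fintype.card β : ℤ) - 2) ^ (L + 1) + (fixedColors σ).card - 1 +
      walkNum (Fintype.card β - 1) L ≤ avoidCount σ j := by
  rw [mem_fixedColors] at hj
  push Not at hj
  obtain ⟨v, hv⟩ := hj
  rw [← avoidCount_rotate σ j (v - Fin.last L), ← fixedColors_rotate σ (v - Fin.last L)]
  refine le_avoidCount_of_last hL _ ?_
  simpa using hv

/-- The number of colorings with the identity permutations. -/
theorem avoidCount_one (L : ℕ) (j : β) :
    (avoidCount (L := L) (fun _ => 1) j : ℤ) =
      ((Fintype.card β : ℤ) - 2) ^ (L + 1) + (-1) ^ (L + 1) * (Fintype.card β - 2) := by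
  have h := le_antisymm (avoidCount_le_card_bypass (L := L) (fun _ => 1) j fun _ => rfl)
    (card_bypass_le_avoidCount _ j)
  rw [h, cast_card_cycle]
  have h1 : (Finset.univ.filter fun x => pathPerm (L + 1)
      (fun _ => bypass (1 : Equiv.Perm β) j) x = x) = Finset.univ :=
    Finset.filter_true_of_mem fun x _ => pathPerm_apply_eq_self _ _ _ fun i => bypass_eq_self rfl
  rw [h1, Finset.card_univ, cast_card_ne]
  ring

end DPColoring

/-! ### The numerical inequality and the AM-GM step -/

namespace DPColoring

/-- Divide by `A ^ (p + q)` and apply Bernoulli to both powers; the product of the two linear bounds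
is at least `1` by the hypothesis `h`. -/
theorem pow_le_pow_mul_pow {p q : ℕ} {A D : ℝ} (hA : 0 < A) (hD : 0 ≤ D) (hq : (q : ℝ) ≤ A)
    (h : q * p * (D + p) ≤ D * A) :
    A ^ (p + q) ≤ (A - q) ^ p * (A + D + p) ^ q := by
  have h1 : (1 : ℝ) + p * (-(q / A)) ≤ (1 + -(q / A)) ^ p :=
    one_add_mul_le_pow (by have := (div_le_one hA).2 hq; linarith) p
  have h2 : (1 : ℝ) + q * ((D + p) / A) ≤ (1 + (D + p) / A) ^ q :=
    one_add_mul_le_pow (by have : 0 ≤ (D + p) / A := by positivity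
                           linarith) q
  have h3 : (1 : ℝ) ≤ (1 + p * (-(q / A))) * (1 + q * ((D + p) / A)) := by
    have : (1 + p * (-(q / A))) * (1 + q * ((D + p) / A)) =
        1 + q * (D * A - q * p * (D + p)) / A ^ 2 := by
      field_simp
      ring
    rw [this]
    have : 0 ≤ q * (D * A - q * p * (D + p)) / A ^ 2 := by
      have : 0 ≤ D * A - q * p * (D + p) := by linarith
      positivity
    linarith
  have h4 : (0 : ℝ) ≤ 1 + q * ((D + p) / A) := by positivity
  have h5 : (0 : ℝ) ≤ (1 + -(q / A)) ^ p := by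
    have := (div_le_one hA).2 hq
    exact pow_nonneg (by linarith) _
  have h6 := h3.trans ((mul_le_mul_of_nonneg_right h1 h4).trans (mul_le_mul_of_nonneg_left h2 h5))
  have e1 : A - q = A * (1 + -(q / A)) := by field_simp; ring
  have e2 : A + D + p = A * (1 + (D + p) / A) := by field_simp; ring
  rw [e1, e2, mul_pow, mul_pow, pow_add]
  calc A ^ p * A ^ q = A ^ p * A ^ q * 1 := by ring
    _ ≤ A ^ p * A ^ q * ((1 + -(q / A)) ^ p * (1 + (D + p) / A) ^ q) := by gcongr
    _ = _ := by ring

/-- The numerical inequality for even cycles: `p` colors are fixed, and `q` are moved. -/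
theorem pow_le_of_walkNum {p q L : ℕ} {N : ℤ} (hN : 3 ≤ N) (hpq : (p + q : ℤ) = N + 2) (hL : Odd L)
    (hL3 : 3 ≤ L) :
    (N ^ (L + 1) + N) ^ (p + q) ≤
      (N ^ (L + 1) + p - 2) ^ p * (N ^ (L + 1) + p - 1 + walkNum (N + 1) L) ^ q := by
  have hw := mul_walkNum (N + 1) L
  rw [hL.neg_one_pow, add_sub_cancel_right] at hw
  set w := walkNum (N + 1) L
  have hNL : N ^ 3 ≤ N ^ L := pow_le_pow_right₀ (by linarith) hL3
  -- From `(N + 1) w = N^L + 1 ≥ N^3 + 1 = (N + 1)(N^2 - N + 1)`.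
  have hw' : N ^ 2 - N + 1 ≤ w := by
    have : (N + 1) * (N ^ 2 - N + 1) ≤ (N + 1) * w := by linarith
    exact le_of_mul_le_mul_left this (by linarith)
  have hA : N * N ^ 3 ≤ N ^ (L + 1) := by
    rw [pow_succ' N L]; exact mul_le_mul_of_nonneg_left hNL (by linarith)
  have hA' : (N + 2) ^ 2 ≤ N ^ (L + 1) := by
    have h9 : 9 ≤ N ^ 2 := by nlinarith
    nlinarith [mul_le_mul_of_nonneg_left h9 (sq_nonneg N)]
  have hp : (p : ℤ) ≤ N + 2 := by linarith [Int.natCast_nonneg q]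
  have hq : (q : ℤ) ≤ N + 2 := by linarith [Int.natCast_nonneg p]
  -- This is where `N ≥ 3`, that is `m ≥ 5`, enters: `N^2 - 2N ≥ N`.
  have hD : N ≤ w - (N + 1) := by nlinarith
  -- With `D = w - (N + 1)` and `A = N^(L+1) + N`: `p ≤ N + 2 ≤ 2D` gives `D + p ≤ 3D`, and `4pq ≤
  -- (p + q)^2 = (N + 2)^2 ≤ N^(L+1)` gives `3pq ≤ A`.
  have key : (q * p * (w - (N + 1) + p) : ℤ) ≤ (w - (N + 1)) * (N ^ (L + 1) + N) := by
    have h1 : (4 * (q * p) : ℤ) ≤ (N + 2) ^ 2 := by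
      rw [← hpq]; nlinarith [sq_nonneg ((p : ℤ) - q)]
    have h2 : (w - (N + 1) + p : ℤ) ≤ 3 * (w - (N + 1)) := by linarith
    have h3 : (0 : ℤ) ≤ q * p := by positivity
    have h4 : (q * p * (w - (N + 1) + p) : ℤ) ≤ q * p * (3 * (w - (N + 1))) :=
      mul_le_mul_of_nonneg_left h2 h3
    have h5 : (w - (N + 1)) * (3 * (q * p)) ≤ (w - (N + 1)) * (N ^ (L + 1) + N) :=
      mul_le_mul_of_nonneg_left (by linarith) (by linarith)
    linarith
  have := pow_le_pow_mul_pow (p := p) (q := q) (A := ((N ^ (L + 1) + N : ℤ) : ℝ))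
    (D := ((w - (N + 1) : ℤ) : ℝ)) (by
      have : 0 < N ^ (L + 1) + N := by positivity
      exact_mod_cast this) (by
      have : 0 ≤ w - (N + 1) := by linarith
      exact_mod_cast this) (by
      have : (q : ℤ) ≤ N ^ (L + 1) + N := by nlinarith
      exact_mod_cast this) (by exact_mod_cast key)
  have e1 : N ^ (L + 1) + p - 2 = N ^ (L + 1) + N - q := by linarith
  have e2 : N ^ (L + 1) + p - 1 + w = N ^ (L + 1) + N + (w - (N + 1)) + p := by ring
  rw [e1, e2]
  exact_mod_cast this

variable {β : Type*} [Fintype β] [DecidableEq β]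

/-- The geometric mean of the numbers of colorings of a cycle avoiding the various colors. -/
theorem pow_le_prod_avoidCount {L : ℕ} (hL : 2 ≤ L) (hβ : 5 ≤ Fintype.card β)
    (σ : Fin (L + 1) → Equiv.Perm β) :
    (((Fintype.card β : ℤ) - 2) ^ (L + 1) + (-1) ^ (L + 1) * (Fintype.card β - 2)) ^
      Fintype.card β ≤ ∏ j, (avoidCount σ j : ℤ) := by
  have hβ' : (5 : ℤ) ≤ Fintype.card β := by exact_mod_cast hβ
  have hN : (3 : ℤ) ≤ (Fintype.card β : ℤ) - 2 := by linarith
  set N : ℤ := (Fintype.card β : ℤ) - 2 with hNdef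
  rcases Nat.even_or_odd L with hev | hodd
  · rw [hev.add_one.neg_one_pow, ← Finset.card_univ, ← Finset.prod_const]
    refine Finset.prod_le_prod (fun j _ => ?_) fun j _ => ?_
    · have : N ^ 1 ≤ N ^ (L + 1) := pow_le_pow_right₀ (by linarith) (by omega)
      linarith
    · have := le_avoidCount_of_odd hev σ j
      linarith
  · rw [hodd.add_one.neg_one_pow, one_mul]
    have hcard : (fixedColors σ).card + (fixedColors σ)ᶜ.card = Fintype.card β :=
      Finset.card_add_card_compl _
    have hL3 : 3 ≤ L := by
      obtain ⟨r, rfl⟩ := hodd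
      omega
    have h := pow_le_of_walkNum (p := (fixedColors σ).card) (q := (fixedColors σ)ᶜ.card) hN
      (by rw [hNdef, ← hcard]; push_cast; ring) hodd hL3
    rw [hcard] at h
    refine h.trans ?_
    -- The `p` common fixed colors and the `q` moved colors have different lower bounds, matching
    -- the two powers in the numerical inequality.
    rw [← Finset.prod_mul_prod_compl (fixedColors σ), ← Finset.prod_const, ← Finset.prod_const]
    have hpow : 27 ≤ N ^ (L + 1) :=
      calc (27 : ℤ) ≤ N ^ 3 := by nlinarith [sq_nonneg N]
        _ ≤ N ^ (L + 1) := pow_le_pow_right₀ (by linarith) (by omega)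
    have hw : 0 ≤ walkNum (N + 1) L := by
      have hw := mul_walkNum (N + 1) L
      rw [hodd.neg_one_pow, add_sub_cancel_right] at hw
      have : 0 < N ^ L := pow_pos (by linarith) _
      exact nonneg_of_mul_nonneg_right (by linarith) (show 0 < N + 1 by linarith)
    refine mul_le_mul ?_ ?_ (Finset.prod_nonneg fun j _ => by linarith)
      (Finset.prod_nonneg fun j _ => by positivity)
    · exact Finset.prod_le_prod (fun j _ => by linarith) fun j hj => le_avoidCount_of_mem hodd σ hj
    · refine Finset.prod_le_prod (fun j _ => by linarith) fun j hj => ?_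
      have := le_avoidCount_of_notMem hodd σ (Finset.mem_compl.1 hj)
      rwa [show (Fintype.card β : ℤ) - 1 = N + 1 by rw [hNdef]; ring] at this

/-- The arithmetic–geometric mean step combining several cycles. -/
theorem card_mul_prod_le_sum_prod {ι : Type*} [Fintype ι] {κ : Type*} [Fintype κ]
    (A : ι → ℝ) (hA : ∀ i, 0 < A i)
    (a : ι → κ → ℝ) (ha' : ∀ i j, 0 ≤ a i j)
    (h : ∀ i, A i ^ Fintype.card κ ≤ ∏ j, a i j) :
    Fintype.card κ * ∏ i, A i ≤ ∑ j, ∏ i, a i j := by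
  have hP : 0 < ∏ i, A i := Finset.prod_pos fun i _ => hA i
  have ha : ∀ i j, 0 < a i j := fun i j => (ha' i j).lt_of_ne' fun h0 =>
    ((pow_pos (hA i) _).trans_le (h i)).ne' (Finset.prod_eq_zero (Finset.mem_univ j) h0)
  have hx : ∀ j, 0 < (∏ i, a i j) / ∏ i, A i := fun j =>
    div_pos (Finset.prod_pos fun i _ => ha i j) hP
  have h1 : (1 : ℝ) ≤ ∏ j, ((∏ i, a i j) / ∏ i, A i) := by
    rw [Finset.prod_div_distrib, Finset.prod_const, Finset.card_univ, ← Finset.prod_pow,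
      Finset.prod_comm, one_le_div (Finset.prod_pos fun i _ => pow_pos (hA i) _)]
    exact Finset.prod_le_prod (fun i _ => (pow_pos (hA i) _).le) fun i _ => h i
  have h2 : 0 ≤ ∑ j, Real.log ((∏ i, a i j) / ∏ i, A i) := by
    rw [← Real.log_prod fun j _ => (hx j).ne']
    exact Real.log_nonneg h1
  -- AM-GM in the form `log x ≤ x - 1`: the normalized products have product at least `1`, so their
  -- sum is at least their number.
  have h3 : ∑ j, Real.log ((∏ i, a i j) / ∏ i, A i) ≤ ∑ j, ((∏ i, a i j) / (∏ i, A i) - 1) :=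
    Finset.sum_le_sum fun j _ => Real.log_le_sub_one_of_pos (hx j)
  rw [Finset.sum_sub_distrib, Finset.sum_const, Finset.card_univ, ← Finset.sum_div] at h3
  rw [← le_div_iff₀ hP]
  simp at h3
  linarith

end DPColoring

/-! ### Covers, their colorings, and extension of matchings -/

namespace DPColoring

section Cover

variable {V W : Type*} {G : SimpleGraph V}

theorem Cover.eq_of_mem (C : Cover G W) {u v : V} {x : W} (hu : x ∈ C.L u) (hv : x ∈ C.L v) :
    u = v :=
  C.injective ((C.isPartition.2 x).unique ⟨⟨u, rfl⟩, hu⟩ ⟨⟨v, rfl⟩, hv⟩)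

theorem Cover.exists_mem (C : Cover G W) (x : W) : ∃ u, x ∈ C.L u := by
  obtain ⟨_, ⟨⟨u, rfl⟩, hx⟩, _⟩ := C.isPartition.2 x
  exact ⟨u, hx⟩

/-- Colorings from a cover are the same as independent choices of an element of each list. -/
theorem Cover.numColorings_eq [Finite V] (C : Cover G W) :
    C.numColorings = Nat.card {c : V → W //
      (∀ v, c v ∈ C.L v) ∧ ∀ u v, G.Adj u v → ¬ C.H.Adj (c u) (c v)} := by
  classical
  have := Fintype.ofFinite V
  have hinj : ∀ c : V → W, (∀ v, c v ∈ C.L v) → Function.Injective c := fun c hc u v h =>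
    C.eq_of_mem (hc u) (h ▸ hc v)
  rw [Cover.numColorings, ← Nat.card_coe_set_eq]
  symm
  refine Nat.card_eq_of_bijective (fun c => ⟨Finset.univ.image c.1, ?_, ?_⟩) ⟨?_, ?_⟩
  · intro x hx y hy hne hadj
    simp only [Finset.coe_image, Finset.coe_univ, Set.image_univ, Set.mem_range] at hx hy
    obtain ⟨u, rfl⟩ := hx
    obtain ⟨v, rfl⟩ := hy
    rcases C.eq_or_adj u v _ (c.2.1 u) _ (c.2.1 v) hadj with rfl | h
    · exact hne rfl
    · exact c.2.2 u v h hadj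
  · rw [Finset.card_image_of_injective _ (hinj c.1 c.2.1), Finset.card_univ,
      Nat.card_eq_fintype_card]
  · intro c d h
    have h' : Finset.univ.image c.1 = Finset.univ.image d.1 := congrArg Subtype.val h
    refine Subtype.ext (funext fun v => ?_)
    have hv : c.1 v ∈ Finset.univ.image d.1 := h' ▸ Finset.mem_image_of_mem _ (Finset.mem_univ v)
    obtain ⟨w, -, hw⟩ := Finset.mem_image.1 hv
    rw [← hw, C.eq_of_mem (d.2.1 w) (hw ▸ c.2.1 v)]
  -- Parts are cliques, so `s` has at most one element in each; having `|V|` elements, it meets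
  -- every part exactly once.
  · rintro ⟨s, hs, hcard⟩
    choose p hp using C.exists_mem
    have hpinj : Set.InjOn p s := by
      intro x hx y hy hxy
      by_contra hne
      exact hs hx hy hne (C.isClique (p x) (hp x) (hxy ▸ hp y) hne)
    have himg : s.image p = Finset.univ := by
      rw [← Finset.card_eq_iff_eq_univ, Finset.card_image_of_injOn hpinj, hcard,
        Nat.card_eq_fintype_card]
    have hex : ∀ v, ∃ x ∈ s, p x = v := fun v => by
      have := Finset.mem_univ v
      rwa [← himg, Finset.mem_image] at this
    choose c hcs hcp using hex
    have hcL : ∀ v, c v ∈ C.L v := fun v => by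
      have := hp (c v)
      rwa [hcp] at this
    refine ⟨⟨c, hcL, fun u v huv hadj => hs (hcs u) (hcs v) hadj.ne hadj⟩, Subtype.ext ?_⟩
    refine Finset.eq_of_subset_of_card_le (Finset.image_subset_iff.2 fun v _ => hcs v) ?_
    rw [hcard, Finset.card_image_of_injective _ (hinj c hcL), Finset.card_univ,
      Nat.card_eq_fintype_card]

end Cover

/-- The second coordinates of a coloring from the canonical cover form a proper coloring that
determines it. -/
theorem dpColorFunction_le_chromaticPoly {V : Type} [Finite V] (G : SimpleGraph V) {m : ℕ}
    (hm : 1 ≤ m) : dpColorFunction G m ≤ chromaticPoly G m := by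
  have hfold : (canonicalCover G m hm).IsFold m := by
    refine fun u => ⟨Set.toFinite _, ?_⟩
    have : (canonicalCover G m hm).L u = Set.range (fun i : Fin m => (u, i)) := by
      ext ⟨a, i⟩
      simp [canonicalCover, eq_comm]
    rw [this, ← Set.image_univ, Set.ncard_image_of_injective _ (Prod.mk_right_injective u),
      Set.ncard_univ, Nat.card_eq_fintype_card, Fintype.card_fin]
  have hle : dpColorFunction G m ≤ (canonicalCover G m hm).numColorings :=
    Nat.sInf_le ⟨V × Fin m, inferInstance, canonicalCover G m hm, hfold, rfl⟩
  refine hle.trans ?_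
  · have : Finite (G.Coloring (Fin m)) :=
      Finite.of_injective (fun c : G.Coloring (Fin m) => (c : V → Fin m)) DFunLike.coe_injective
    rw [Cover.numColorings_eq, chromaticPoly]
    refine Nat.card_le_card_of_injective
      (fun c => Coloring.mk (fun v => (c.1 v).2) fun {u v} huv h => ?_) ?_
    · refine c.2.2 u v huv ?_
      have hu : (c.1 u).1 = u := c.2.1 u
      have hv : (c.1 v).1 = v := c.2.1 v
      refine boxProd_adj.2 (Or.inl ⟨?_, h⟩)
      rwa [hu, hv]
    · intro c d h
      refine Subtype.ext (funext fun v => Prod.ext ?_ ?_)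
      · exact (c.2.1 v : (c.1 v).1 = v).trans (d.2.1 v : (d.1 v).1 = v).symm
      · exact DFunLike.congr_fun h v

/-- A partial matching between two finite types of the same size extends to a bijection. -/
theorem exists_equiv_of_matching {A B : Type*} [Finite A] [Finite B] (h : Nat.card A = Nat.card B)
    (R : A → B → Prop) (h1 : ∀ a b b', R a b → R a b' → b = b')
    (h2 : ∀ a a' b, R a b → R a' b → a = a') : ∃ e : A ≃ B, ∀ a b, R a b → e a = b := by
  classical
  have := Fintype.ofFinite A
  have := Fintype.ofFinite B
  rw [Nat.card_eq_fintype_card, Nat.card_eq_fintype_card] at h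
  obtain ⟨e0⟩ := Fintype.card_eq.1 h
  let f : A → B := fun a => if h : ∃ b, R a b then h.choose else e0 a
  have hf : ∀ a b, R a b → f a = b := fun a b hab => by
    have h : ∃ b, R a b := ⟨b, hab⟩
    simp only [f, dif_pos h]
    exact h1 a _ _ h.choose_spec hab
  obtain ⟨g, hg⟩ := Finset.exists_equiv_extend_of_card_eq (t := (Finset.univ : Finset B))
    (by rw [h, Finset.card_univ]) (s := Finset.univ.filter fun a => ∃ b, R a b) (f := f)
    (Finset.subset_univ _) (by
      intro a ha a' ha' haa
      simp only [Finset.coe_filter, Finset.mem_univ, true_and, Set.mem_ofPred_eq] at ha ha'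
      obtain ⟨b, hb⟩ := ha
      obtain ⟨b', hb'⟩ := ha'
      rw [hf a b hb, hf a' b' hb'] at haa
      exact h2 a a' b hb (haa ▸ hb'))
  refine ⟨g.trans (Equiv.subtypeUnivEquiv Finset.mem_univ), fun a b hab => ?_⟩
  exact (hg a (by simpa using ⟨b, hab⟩)).trans (hf a b hab)

/-! ### Counting colorings of the cone by the color of the apex -/

section Cone

variable {V : Type*} {G : SimpleGraph V}

theorem cone_adj_inl_inr (a : Fin 1) (x : V) : (cone G).Adj (Sum.inl a) (Sum.inr x) := by
  simp [cone, join]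

theorem not_cone_adj_inl_inl (a b : Fin 1) : ¬ (cone G).Adj (Sum.inl a) (Sum.inl b) := by
  simp [cone, join, Subsingleton.elim a b]

theorem cone_adj_inr_inr {x y : V} : (cone G).Adj (Sum.inr x) (Sum.inr y) ↔ G.Adj x y := by
  simp [cone, join]

end Cone

theorem cycleGraph_adj_iff {L : ℕ} (hL : 1 ≤ L) {a b : Fin (L + 1)} :
    (cycleGraph (L + 1)).Adj a b ↔ b = a + 1 ∨ a = b + 1 := by
  obtain ⟨L, rfl⟩ := Nat.exists_eq_add_of_le' hL
  rw [cycleGraph_adj, sub_eq_iff_eq_add', sub_eq_iff_eq_add', or_comm]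

variable {n : ℕ}

/-- Colorings of a cone of cycles from a cover, counted by the color of the apex. -/
theorem exists_sum_prod_avoidCount_le {L : Fin n → ℕ} (hL : ∀ i, 1 ≤ L i) {m : ℕ} {W : Type*}
    [Finite W] (C : Cover (cone (disjointUnion fun i => cycleGraph (L i + 1))) W)
    (hC : C.IsFold m) :
    ∃ σ : ∀ i, Fin (L i + 1) → Equiv.Perm (Fin m),
      ∑ j, ∏ i, avoidCount (σ i) j ≤ C.numColorings := by
  have hcard : ∀ u, Nat.card (Fin m) = Nat.card (C.L u) := fun u => by
    rw [Nat.card_coe_set_eq, (hC u).2, Nat.card_eq_fintype_card, Fintype.card_fin]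
  have hmatch : ∀ u v, (cone (disjointUnion fun i => cycleGraph (L i + 1))).Adj u v →
      ∀ (e : Fin m ≃ C.L u) (e' : Fin m ≃ C.L v), ∃ g : Fin m ≃ Fin m,
        ∀ a b, C.H.Adj (e a) (e' b) → g a = b := fun u v huv e e' =>
    exists_equiv_of_matching rfl (fun a b => C.H.Adj (e a) (e' b))
      (fun a b b' h h' => e'.injective (Subtype.ext
        (C.matching u v huv _ (e a).2 _ (e' b).2 _ (e' b').2 h h')))
      (fun a a' b h h' => e.injective (Subtype.ext
        (C.matching v u huv.symm _ (e' b).2 _ (e a).2 _ (e a').2 h.symm h'.symm)))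
  have hw : Nat.card (C.L (Sum.inl 0)) = m := by rw [Nat.card_coe_set_eq, (hC _).2]
  let e₀ : Fin m ≃ C.L (Sum.inl 0) := (Finite.equivFinOfCardEq hw).symm
  -- Each rim list is labeled by the apex list along a completed spoke matching, so apex color `j`
  -- can only conflict with label `j`.
  have hspoke : ∀ x, ∃ e : Fin m ≃ C.L (Sum.inr x),
      ∀ j b, C.H.Adj (e₀ j) (b : C.L (Sum.inr x)) → e j = b := fun x =>
    exists_equiv_of_matching (hcard _) (fun j b => C.H.Adj (e₀ j) b)
      (fun j b b' h h' => Subtype.ext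
        (C.matching _ _ (cone_adj_inl_inr 0 x) _ (e₀ j).2 _ b.2 _ b'.2 h h'))
      (fun j j' b h h' => e₀.injective (Subtype.ext
        (C.matching _ _ (cone_adj_inl_inr 0 x).symm _ b.2 _ (e₀ j).2 _ (e₀ j').2 h.symm h'.symm)))
  choose e he using hspoke
  -- In these labels each rim matching is contained in the graph of a permutation; forbidding the
  -- whole permutation can only lose colorings.
  have hcyc : ∀ i, ∀ v : Fin (L i + 1), ∃ g : Equiv.Perm (Fin m),
      ∀ a b, C.H.Adj (e ⟨i, v⟩ a) (e ⟨i, v + 1⟩ b) → g a = b := fun i v =>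
    hmatch _ _ (cone_adj_inr_inr.2
      ⟨i, v, v + 1, (cycleGraph_adj_iff (hL i)).2 (Or.inl rfl), rfl, rfl⟩) _ _
  choose σ hσ using hcyc
  refine ⟨σ, ?_⟩
  have hcount : ∑ j, ∏ i, avoidCount (σ i) j = Nat.card (Σ j, ∀ i,
      {f : Fin (L i + 1) → Fin m // ∀ v, f v ≠ j ∧ f (v + 1) ≠ σ i v (f v)}) := by
    rw [Nat.card_sigma]
    exact Finset.sum_congr rfl fun j _ => Nat.card_pi.symm
  rw [hcount, C.numColorings_eq]
  let c : (Σ j, ∀ i, {f : Fin (L i + 1) → Fin m // ∀ v, f v ≠ j ∧ f (v + 1) ≠ σ i v (f v)}) →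
      (Fin 1 ⊕ Σ i, Fin (L i + 1)) → W := fun p =>
    Sum.elim (fun _ => e₀ p.1) fun x => e x ((p.2 x.1).1 x.2)
  have hspoke : ∀ p x, ¬ C.H.Adj (e₀ p.1) (c p (Sum.inr x)) := fun p x h =>
    ((p.2 x.1).2 x.2).1 ((e x).injective (he x _ (e x ((p.2 x.1).1 x.2)) h)).symm
  have hrim : ∀ p i (v : Fin (L i + 1)),
      ¬ C.H.Adj (c p (Sum.inr ⟨i, v⟩)) (c p (Sum.inr ⟨i, v + 1⟩)) := fun p i v h =>
    ((p.2 i).2 v).2 (hσ i v _ _ h).symm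
  refine Nat.card_le_card_of_injective (fun p => ⟨c p, ?_, ?_⟩) ?_
  · rintro (a | x)
    · rw [Subsingleton.elim a 0]
      exact (e₀ p.1).2
    · exact (e x _).2
  · rintro (a | x) (b | y) huv
    · exact absurd huv (not_cone_adj_inl_inl a b)
    · exact hspoke p y
    · exact fun h => hspoke p x h.symm
    · obtain ⟨i, v, w, hvw, rfl, rfl⟩ := cone_adj_inr_inr.1 huv
      rcases (cycleGraph_adj_iff (hL i)).1 hvw with rfl | rfl
      · exact hrim p i v
      · exact fun h => hrim p i w h.symm
  · rintro ⟨j, f⟩ ⟨j', f'⟩ h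
    have h' : c ⟨j, f⟩ = c ⟨j', f'⟩ := congrArg Subtype.val h
    obtain rfl : j = j' := e₀.injective (Subtype.ext (congrFun h' (Sum.inl 0)))
    congr 1
    funext i
    refine Subtype.ext (funext fun v => ?_)
    exact (e ⟨i, v⟩).injective (Subtype.ext (congrFun h' (Sum.inr ⟨i, v⟩)))

/-- Proper colorings of a cone of cycles, counted by the color of the apex. -/
theorem chromaticPoly_le_sum_prod_avoidCount {L : Fin n → ℕ} (hL : ∀ i, 1 ≤ L i) (m : ℕ) :
    chromaticPoly (cone (disjointUnion fun i => cycleGraph (L i + 1))) m ≤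
      ∑ j : Fin m, ∏ i, avoidCount (L := L i) (fun _ => 1) j := by
  have hcount : ∑ j : Fin m, ∏ i, avoidCount (L := L i) (fun _ => 1) j =
      Nat.card (Σ j : Fin m, ∀ i, {f : Fin (L i + 1) → Fin m //
        ∀ v, f v ≠ j ∧ f (v + 1) ≠ (1 : Equiv.Perm (Fin m)) (f v)}) := by
    rw [Nat.card_sigma]
    exact Finset.sum_congr rfl fun j _ => Nat.card_pi.symm
  rw [hcount, chromaticPoly]
  refine Nat.card_le_card_of_injective (fun c => ⟨c (Sum.inl 0), fun i =>
    ⟨fun v => c (Sum.inr ⟨i, v⟩), fun v => ⟨?_, ?_⟩⟩⟩) ?_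
  · exact (c.valid (cone_adj_inl_inr 0 _)).symm
  · exact (c.valid (cone_adj_inr_inr.2
      ⟨i, v, v + 1, (cycleGraph_adj_iff (hL i)).2 (Or.inl rfl), rfl, rfl⟩)).symm
  · intro c d h
    have h0 : c (Sum.inl 0) = d (Sum.inl 0) := congrArg Sigma.fst h
    refine DFunLike.ext _ _ ?_
    rintro (a | ⟨i, v⟩)
    · rw [Subsingleton.elim a 0]
      exact h0
    · have := congrArg (fun p : (Σ j : Fin m, ∀ i, {f : Fin (L i + 1) → Fin m //
        ∀ v, f v ≠ j ∧ f (v + 1) ≠ (1 : Equiv.Perm (Fin m)) (f v)}) => (p.2 i).1 v) h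
      exact this

/-! ### Comparison with the chromatic polynomial and conclusion -/

/-- The chromatic polynomial of the cycle of length `k`, evaluated at `m - 1`. -/
def cyclePoly (k m : ℕ) : ℤ := ((m : ℤ) - 2) ^ k + (-1) ^ k * (m - 2)

theorem cyclePoly_pos {k m : ℕ} (hk : 2 ≤ k) (hm : 5 ≤ m) : 0 < cyclePoly k m := by
  have hN : (3 : ℤ) ≤ (m : ℤ) - 2 := by
    have : (5 : ℤ) ≤ m := by exact_mod_cast hm
    linarith
  rw [cyclePoly]
  have h2 : ((m : ℤ) - 2) ^ 2 ≤ ((m : ℤ) - 2) ^ k := pow_le_pow_right₀ (by linarith) hk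
  rcases neg_one_pow_eq_or ℤ k with h | h <;> rw [h] <;> nlinarith

theorem chromaticPoly_le {L : Fin n → ℕ} (hL : ∀ i, 1 ≤ L i) (m : ℕ) :
    (chromaticPoly (cone (disjointUnion fun i => cycleGraph (L i + 1))) m : ℤ) ≤
      m * ∏ i, cyclePoly (L i + 1) m := by
  refine (Int.ofNat_le.2 (chromaticPoly_le_sum_prod_avoidCount hL m)).trans_eq ?_
  have h1 : ∀ i (j : Fin m),
      (avoidCount (L := L i) (fun _ => 1) j : ℤ) = cyclePoly (L i + 1) m := fun i j => by
    rw [avoidCount_one, Fintype.card_fin, cyclePoly]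
  push_cast
  simp [h1]

/-- Applied to a cover attaining the minimum: the geometric-mean bound for each cycle feeds the
AM-GM step over the apex colors. -/
theorem le_dpColorFunction {L : Fin n → ℕ} (hL : ∀ i, 2 ≤ L i) {m : ℕ} (hm : 5 ≤ m) :
    (m * ∏ i, cyclePoly (L i + 1) m : ℤ) ≤
      dpColorFunction (cone (disjointUnion fun i => cycleGraph (L i + 1))) m := by
  obtain ⟨W, _, C, hC, hnum⟩ := exists_cover_eq_dpColorFunction
    (cone (disjointUnion fun i => cycleGraph (L i + 1))) (show 1 ≤ m by omega)
  obtain ⟨σ, hσ⟩ := exists_sum_prod_avoidCount_le (fun i => (hL i).trans' one_le_two) C hC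
  refine le_trans ?_ (Int.ofNat_le.2 (hσ.trans hnum.le))
  have hpos : ∀ i, 0 < cyclePoly (L i + 1) m := fun i =>
    cyclePoly_pos ((hL i).trans (Nat.le_succ _)) hm
  have h := card_mul_prod_le_sum_prod (fun i => (cyclePoly (L i + 1) m : ℝ))
    (fun i => by exact_mod_cast hpos i)
    (fun i (j : Fin m) => (avoidCount (σ i) j : ℝ)) (fun i j => by positivity) fun i => by
      have := pow_le_prod_avoidCount (hL i) (by rwa [Fintype.card_fin]) (σ i)
      rw [Fintype.card_fin] at this ⊢
      exact_mod_cast this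
  rw [Fintype.card_fin] at h
  exact_mod_cast h

/-- The DP color function of a cone of cycles agrees with its chromatic polynomial. -/
theorem dpColorFunction_eq_chromaticPoly {L : Fin n → ℕ} (hL : ∀ i, 2 ≤ L i) {m : ℕ}
    (hm : 5 ≤ m) :
    dpColorFunction (cone (disjointUnion fun i => cycleGraph (L i + 1))) m =
      chromaticPoly (cone (disjointUnion fun i => cycleGraph (L i + 1))) m :=
  le_antisymm (dpColorFunction_le_chromaticPoly _ (by omega)) (Int.ofNat_le.1
    ((chromaticPoly_le (fun i => (hL i).trans' one_le_two) m).trans (le_dpColorFunction hL hm)))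

/-- The threshold only admits `N ≥ χ`; the lower bound is positive at `m = 5`, so a proper
5-coloring exists. -/
theorem chromaticNumber_le_five {L : Fin n → ℕ} (hL : ∀ i, 2 ≤ L i) :
    (cone (disjointUnion fun i => cycleGraph (L i + 1))).chromaticNumber ≤ 5 := by
  have h := le_dpColorFunction hL le_rfl
  rw [dpColorFunction_eq_chromaticPoly hL le_rfl] at h
  have hpos : (0 : ℤ) < (5 : ℕ) * ∏ i, cyclePoly (L i + 1) 5 :=
    mul_pos (by norm_num) (Finset.prod_pos fun i _ =>
      cyclePoly_pos ((hL i).trans (Nat.le_succ _)) le_rfl)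
  obtain ⟨⟨c⟩, -⟩ := Nat.card_pos_iff.1 (Int.natCast_pos.1 (hpos.trans_le h))
  exact chromaticNumber_le_iff_colorable.2 ⟨c⟩

end DPColoring

theorem mainTheorem8 (n : ℕ) (hn : 2 ≤ n) (k : Fin n → ℕ) (hk : ∀ i, 3 ≤ k i) :
    (∀ m : ℕ, 5 ≤ m →
      DPColoring.dpColorFunction
          (DPColoring.cone (DPColoring.disjointUnion fun i => SimpleGraph.cycleGraph (k i))) m =
        DPColoring.chromaticPoly
          (DPColoring.cone (DPColoring.disjointUnion fun i => SimpleGraph.cycleGraph (k i))) m) ∧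
    DPColoring.dpThreshold
      (DPColoring.cone (DPColoring.disjointUnion fun i => SimpleGraph.cycleGraph (k i))) ≤ 5 := by
  -- Writing lengths as `L i + 1` makes `v + 1` in `Fin (L i + 1)` the cyclic successor.
  obtain ⟨L, rfl⟩ : ∃ L : Fin n → ℕ, k = fun i => L i + 1 :=
    ⟨fun i => k i - 1, funext fun i =>
      (Nat.sub_add_cancel (le_trans (by norm_num) (hk i))).symm⟩
  have hL : ∀ i, 2 ≤ L i := fun i => Nat.le_of_succ_le_succ (hk i)
  have h : ∀ m : ℕ, 5 ≤ m → _ := fun m hm => DPColoring.dpColorFunction_eq_chromaticPoly hL hm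
  exact ⟨h, iInf₂_le 5 ⟨DPColoring.chromaticNumber_le_five hL, h⟩⟩
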